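/- Let $n\ge 1$, let $A$ be a $d\times n$ integer matrix with columns $a_1,\dots,a_n\in\mathbb Z^d$, and assume that there is $l\in\mathbb R^d$ with $\langle l,a_i\rangle<0$ for all $i$. Let $\Lambda\subseteq\mathbb Z^n$ be any lattice (subgroup) with $A\lambda=0$ for all $\lambda\in\Lambda$. For vectors, $x<y$ means $x_i<y_i$ for all $i$, and $\max$ of a finite set of vectors is taken coordinate-wise. Call $\Lambda$ generic if, whenever $0\ne\lambda\in\Lambda$ has $\lambda_i=0$ for some $i$, there is $\lambda'\in\Lambda$ with $\lambda'<\max(\lambda,0)$. A proper perturbation is a map $\varphi:\Lambda\to\mathbb R^n$ such that for all $x,y\in\Lambda$ and all $i$: (1) if $x\neq y$ then $\varphi(x)_i\ne\varphi(y)_i$; (2) if $\varphi(x)_i<\varphi(y)_i$ then $x_i\le y_i$; (3) if $\varphi(x)_i<\varphi(y)_i$ then $\varphi(x+\lambda)_i<\varphi(y+\lambda)_i$ for all $\lambda\in\Lambda$. Let $S$ be a neighborhood complex of $\Lambda$: either $\Lambda$ is generic and $S$ is the collection of nonempty finite $s\subseteq\Lambda$ such that $\lambda<\max(s)$ for no $\lambda\in\Lambda$;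 or, for some proper perturbation $\varphi$, $S$ is the collection of nonempty finite $s\subseteq\Lambda$ such that $\varphi(\lambda)<\max(\varphi(s))$ for no $\lambda\in\Lambda$. Let $\bar S$ be a set of distinct representatives of $S$ modulo translation by $\Lambda$, and put \[f_{\bar S}(\mathbf z)=\frac{\sum_{s\in\bar S}(-1)^{\dim s}\,\mathbf z^{A\max(s)}}{\prod_{i=1}^n(1-\mathbf z^{a_i})},\qquad \dim s=|s|-1.\] For $b\in\mathbb Z^d$ let $T_b=\{\xi\in\mathbb Z^n:\xi\ge 0,\ A\xi=b\}$ and let $c_b$ be the number of classes of $T_b$ under $\xi\sim\eta\iff\xi-\eta\in\Lambda$. Then every $c_b$ is finite, and for every $\mathbf z\in(\mathbb C\setminus\{0\})^d$ with $|\mathbf z^{a_i}|<1$ for all $i$, the (possibly infinite) sum over $\bar S$ converges absolutely and \[f_{\bar S}(\mathbf z)=\sum_{b\in\mathbb Z^d}c_b\,\mathbf z^b,\] the series on the right converging absolutely. In particular, if $\Lambda=\{\lambda\in\mathbb Z^n:A\lambda=0\}$, then for such $\mathbf z$ one has $f_{\bar S}(\mathbf z)=\sum_{b\in G}\mathbf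 z^b$, where $G=\{A\xi:\xi\in\mathbb Z^n,\ \xi\ge0\}$. -/

import Mathlib

noncomputable section

namespace NbhdComplex

/-- The coordinate-wise maximum of the vectors `v x`, `x ∈ s` (with value `0` if `s = ∅`; it is only
used for nonempty `s`). -/
def coordMax {ι α : Type*} [LinearOrder α] [Zero α] {n : ℕ} (s : Finset ι) (v : ι → Fin n → α) :
    Fin n → α :=
  if h : s.Nonempty then fun i => s.sup' h (fun x => v x i) else 0

/-- The inclusion of a lattice `Λ ⊆ ℤⁿ` into `ℤⁿ`. -/
def incl {n : ℕ} (Λ : AddSubgroup (Fin n → ℤ)) : Λ → Fin n → ℤ := fun x => (x : Fin n → ℤ)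

/-- `Λ` is generic: whenever a nonzero `x ∈ Λ` has a vanishing coordinate, there is `y ∈ Λ` with
`y < max(x, 0)`, the strict inequality holding in every coordinate. -/
def IsGeneric {n : ℕ} (Λ : AddSubgroup (Fin n → ℤ)) : Prop :=
  ∀ x ∈ Λ, x ≠ 0 → (∃ i, x i = 0) → ∃ y ∈ Λ, ∀ i, y i < max (x i) 0

/-- Proper perturbations `φ : Λ → ℝⁿ`. -/
structure IsProperPerturbation {n : ℕ} (Λ : AddSubgroup (Fin n → ℤ)) (φ : Λ → Fin n → ℝ) :
    Prop where
  ne_of_ne : ∀ x y : Λ, x ≠ y → ∀ i, φ x i ≠ φ y i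
  le_of_lt : ∀ (x y : Λ) (i : Fin n), φ x i < φ y i → incl Λ x i ≤ incl Λ y i
  add_lt_add : ∀ (x y : Λ) (i : Fin n), φ x i < φ y i → ∀ w : Λ, φ (x + w) i < φ (y + w) i

/-- The collection of all nonempty finite `s ⊆ Λ` such that there is no `w ∈ Λ` with
`v(w) < max(v(s))`, where `<` means strict inequality in every coordinate. -/
def complexOf {n : ℕ} {α : Type*} [LinearOrder α] [Zero α] (Λ : AddSubgroup (Fin n → ℤ))
    (v : Λ → Fin n → α) : Set (Finset Λ) :=
  {s | s.Nonempty ∧ ¬ ∃ w : Λ, ∀ i, v w i < coordMax s v i}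

/-- `S` is a neighborhood complex of `Λ`: either `Λ` is generic and `S` is defined by the vectors of
`Λ` themselves, or `S` is defined by some proper perturbation of `Λ`. -/
def IsNeighborhoodComplex {n : ℕ} (Λ : AddSubgroup (Fin n → ℤ)) (S : Set (Finset Λ)) : Prop :=
  (IsGeneric Λ ∧ S = complexOf Λ (incl Λ)) ∨
    ∃ φ : Λ → Fin n → ℝ, IsProperPerturbation Λ φ ∧ S = complexOf Λ φ

/-- The translate `s + w`. -/
def translate {n : ℕ} {Λ : AddSubgroup (Fin n → ℤ)} (s : Finset Λ) (w : Λ) : Finset Λ :=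
  s.map (addRightEmbedding w)

/-- `R` is a set of distinct representatives of `S` modulo translation by `Λ`. -/
def IsRepresentatives {n : ℕ} {Λ : AddSubgroup (Fin n → ℤ)} (S R : Set (Finset Λ)) : Prop :=
  R ⊆ S ∧ ∀ s ∈ S, ∃! t, t ∈ R ∧ ∃ w : Λ, s = translate t w

/-- The Laurent monomial `z^b = z₁^{b₁} ⋯ z_d^{b_d}`. -/
def monom {d : ℕ} (z : Fin d → ℂ) (b : Fin d → ℤ) : ℂ := ∏ j, z j ^ b j

/-- The column `a_i` of `A`. -/
def col {d n : ℕ} (A : Matrix (Fin d) (Fin n) ℤ) (i : Fin n) : Fin d → ℤ := fun j => A j i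

/-- The term `(-1)^{dim s} z^{A · max(s)}`, where `dim s = |s| - 1`. -/
def simplexTerm {d n : ℕ} (A : Matrix (Fin d) (Fin n) ℤ) {Λ : AddSubgroup (Fin n → ℤ)}
    (z : Fin d → ℂ) (s : Finset Λ) : ℂ :=
  (-1) ^ (s.card - 1) * monom z (A.mulVec (coordMax s (incl Λ)))

/-- `f_R(z) = (∑_{s ∈ R} (-1)^{dim s} z^{A · max(s)}) / ∏_i (1 - z^{a_i})`. -/
def genFun {d n : ℕ} (A : Matrix (Fin d) (Fin n) ℤ) {Λ : AddSubgroup (Fin n → ℤ)}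
    (R : Set (Finset Λ)) (z : Fin d → ℂ) : ℂ :=
  (∑' s : R, simplexTerm A z (s : Finset Λ)) / ∏ i, (1 - monom z (col A i))

/-- `T_b`, the set of nonnegative integer solutions of `A ξ = b`. -/
def solutions {d n : ℕ} (A : Matrix (Fin d) (Fin n) ℤ) (b : Fin d → ℤ) : Set (Fin n → ℤ) :=
  {ξ | 0 ≤ ξ ∧ A.mulVec ξ = b}

/-- The relation `ξ ∼ η ↔ ξ - η ∈ Λ` on `T_b`. -/
def solutionSetoid {d n : ℕ} (A : Matrix (Fin d) (Fin n) ℤ) (Λ : AddSubgroup (Fin n → ℤ))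
    (b : Fin d → ℤ) : Setoid (solutions A b) where
  r ξ η := (ξ : Fin n → ℤ) - (η : Fin n → ℤ) ∈ Λ
  iseqv :=
    { refl := fun ξ => by simp
      symm := fun {ξ η} h => by simpa using Λ.neg_mem h
      trans := fun {ξ η ζ} h h' => by simpa using Λ.add_mem h h' }

/-- The set of equivalence classes of `T_b` modulo `Λ`. -/
def SolutionClasses {d n : ℕ} (A : Matrix (Fin d) (Fin n) ℤ) (Λ : AddSubgroup (Fin n → ℤ))
    (b : Fin d → ℤ) : Type :=
  Quotient (solutionSetoid A Λ b)

/-- The semigroup `G = {A ξ : ξ ∈ ℤⁿ, ξ ≥ 0}`. -/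
def semigroupOf {d n : ℕ} (A : Matrix (Fin d) (Fin n) ℤ) : Set (Fin d → ℤ) :=
  {b | ∃ ξ : Fin n → ℤ, 0 ≤ ξ ∧ A.mulVec ξ = b}

end NbhdComplex

end

namespace NbhdComplex

/-! ### Sums of products over function spaces -/

/-! Expanding each factor 1/(1 - z^{a_i}) as a geometric series turns f into an absolutely
convergent sum of (-1)^{dim s} z^{A(max(s) + u)} over representatives s and u ∈ ℕⁿ. Up to
translation, such a pair is a class of ℤⁿ/Λ, with chosen element ξ, together with a simplex of S
whose maximum is ≤ ξ (`exists_equiv_simplicesBelow`). Since A kills Λ, the monomial is z^{Aξ}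
throughout the class, so its coefficient is an Euler characteristic: that of the simplices of S
inside the finite set X = {λ ∈ Λ : λ ≤ ξ}.

This is 1 when X is nonempty (`sum_neg_one_pow_dim_eq_one`): among all subsets of X, those with a
lattice point strictly below their maximum cancel in pairs. X is nonempty exactly when the class
contains a nonnegative vector, and c_b counts such classes with Aξ = b.

The numerator converges because a simplex has at most n vertices, one attaining the maximum in each
coordinate (`summable_norm_simplexTerm`). -/

theorem hasSum_prod_pi {K κ : Type*} [NormedField K] [CompleteSpace K] {m : ℕ}
    (f : Fin m → κ → K) (hf : ∀ i, Summable fun k => ‖f i k‖) :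
    (Summable fun u : Fin m → κ => ‖∏ i, f i (u i)‖) ∧
      HasSum (fun u : Fin m → κ => ∏ i, f i (u i)) (∏ i, ∑' k, f i k) := by
  induction m with
  | zero =>
    refine ⟨(hasSum_fintype _).summable, ?_⟩
    convert hasSum_fintype (fun u : Fin 0 → κ => ∏ i, f i (u i)) using 1
    simp
  | succ m ih =>
    obtain ⟨h₁, h₂⟩ := ih (fun i => f i.succ) fun i => hf i.succ
    let e : κ × (Fin m → κ) ≃ (Fin (m + 1) → κ) := Fin.consEquiv fun _ => κ
    have key : ∀ p, ∏ i, f i (e p i) = f 0 p.1 * ∏ i, f i.succ (p.2 i) := fun p => by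
      rw [Fin.prod_univ_succ]
      rfl
    constructor
    · rw [← e.summable_iff]
      have h := (hf 0).mul_norm h₁
      simp only [← key] at h
      exact h
    · rw [← e.hasSum_iff, Fin.prod_univ_succ]
      have h := (hf 0).of_norm.hasSum.mul h₂ ((hf 0).mul_norm h₁).of_norm
      simp only [← key] at h
      exact h

theorem hasSum_prod_pow {K : Type*} [NormedField K] [CompleteSpace K] {m : ℕ}
    {x : Fin m → K} (hx : ∀ i, ‖x i‖ < 1) :
    (Summable fun u : Fin m → ℕ => ‖∏ i, x i ^ u i‖) ∧
      HasSum (fun u : Fin m → ℕ => ∏ i, x i ^ u i) (∏ i, (1 - x i))⁻¹ := by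
  have h := hasSum_prod_pi (fun i k => x i ^ k) fun i => by
    simpa using summable_geometric_of_lt_one (norm_nonneg _) (hx i)
  simpa [tsum_geometric_of_norm_lt_one (hx _)] using h

/-- A summable family takes each nonzero value only finitely often. -/
theorem finite_of_summable_of_eq {ι : Type*} {f : ι → ℝ} (hf : Summable f) {c : ℝ} (hc : 0 < c) :
    {i | f i = c}.Finite := by
  have h := hf.tendsto_cofinite_zero.eventually (gt_mem_nhds hc)
  rw [Filter.eventually_cofinite] at h
  exact h.subset fun i hi => by simp [Set.mem_ofPred_eq.mp hi]

/-! ### Laurent monomials -/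

section Monomials

variable {d n : ℕ} {A : Matrix (Fin d) (Fin n) ℤ} {z : Fin d → ℂ}

theorem zpow_sum₀ {G ι : Type*} [CommGroupWithZero G] {a : G} (ha : a ≠ 0) (s : Finset ι)
    (f : ι → ℤ) : a ^ (∑ i ∈ s, f i) = ∏ i ∈ s, a ^ f i := by
  classical
  induction s using Finset.induction_on with
  | empty => simp
  | insert i s hi ih => rw [Finset.sum_insert hi, Finset.prod_insert hi, zpow_add₀ ha, ih]

theorem monom_add (hz : ∀ j, z j ≠ 0) (b c : Fin d → ℤ) :
    monom z (b + c) = monom z b * monom z c := by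
  simp [monom, zpow_add₀ (hz _), Finset.prod_mul_distrib]

theorem monom_mulVec_natCast (hz : ∀ j, z j ≠ 0) (u : Fin n → ℕ) :
    monom z (A.mulVec fun i => (u i : ℤ)) = ∏ i, monom z (col A i) ^ u i := by
  simp only [monom, col, Matrix.mulVec, dotProduct, zpow_sum₀ (hz _), ← Finset.prod_pow]
  rw [Finset.prod_comm]
  simp [zpow_mul]

theorem mulVec_eq_of_sub_mem {Λ : AddSubgroup (Fin n → ℤ)} (hΛ : ∀ x ∈ Λ, A.mulVec x = 0)
    {ξ η : Fin n → ℤ} (h : ξ - η ∈ Λ) : A.mulVec ξ = A.mulVec η := by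
  have := hΛ _ h
  rwa [Matrix.mulVec_sub, sub_eq_zero] at this

theorem toNat_cast_of_nonneg {ξ : Fin n → ℤ} (h : 0 ≤ ξ) : (fun i => ((ξ i).toNat : ℤ)) = ξ :=
  funext fun i => Int.toNat_of_nonneg (h i)

end Monomials

/-! ### Finiteness -/

section Finiteness

variable {d n : ℕ} {A : Matrix (Fin d) (Fin n) ℤ}

/-- With weights exp⟨l, a_i⟩ < 1, every ξ ∈ T_b gives the same positive term exp⟨l, b⟩ of a
convergent product of geometric series, and a summable family takes that value only finitely often.
-/
theorem finite_solutions (hA : ∃ l : Fin d → ℝ, ∀ i, ∑ j, l j * (A j i : ℝ) < 0)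
    (b : Fin d → ℤ) : (solutions A b).Finite := by
  obtain ⟨l, hl⟩ := hA
  have hρ : ∀ i, ‖Real.exp (∑ j, l j * (A j i : ℝ))‖ < 1 := fun i => by
    simpa using hl i
  have hfin := finite_of_summable_of_eq (hasSum_prod_pow hρ).2.summable
    (Real.exp_pos (∑ j, l j * (b j : ℝ)))
  refine (hfin.image fun u i => (u i : ℤ)).subset fun ξ hξ => ?_
  refine ⟨fun i => (ξ i).toNat, ?_, toNat_cast_of_nonneg hξ.1⟩
  rw [Set.mem_ofPred_eq, ← hξ.2]
  simp only [← Real.exp_nat_mul, ← Real.exp_sum, Matrix.mulVec, dotProduct, Finset.mul_sum,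
    Int.cast_sum, Int.cast_mul]
  rw [Finset.sum_comm]
  refine congrArg Real.exp (Finset.sum_congr rfl fun j _ => Finset.sum_congr rfl fun i _ => ?_)
  have : ((ξ i).toNat : ℝ) = (ξ i : ℝ) := by exact_mod_cast Int.toNat_of_nonneg (hξ.1 i)
  rw [this]
  ring

theorem finite_solutionClasses (hA : ∃ l : Fin d → ℝ, ∀ i, ∑ j, l j * (A j i : ℝ) < 0)
    (Λ : AddSubgroup (Fin n → ℤ)) (b : Fin d → ℤ) : Finite (SolutionClasses A Λ b) :=
  have := (finite_solutions hA b).to_subtype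
  inferInstanceAs (Finite (Quotient (solutionSetoid A Λ b)))

theorem finite_lattice_le (hA : ∃ l : Fin d → ℝ, ∀ i, ∑ j, l j * (A j i : ℝ) < 0)
    {Λ : AddSubgroup (Fin n → ℤ)} (hΛ : ∀ x ∈ Λ, A.mulVec x = 0) (ξ : Fin n → ℤ) :
    {x : Λ | incl Λ x ≤ ξ}.Finite := by
  refine Set.Finite.of_finite_image ((finite_solutions hA (A.mulVec ξ)).subset ?_)
    (f := fun x : Λ => ξ - incl Λ x) fun x _ y _ h => Subtype.ext (sub_right_injective h)
  rintro _ ⟨x, hx, rfl⟩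
  exact ⟨sub_nonneg.2 hx, mulVec_eq_of_sub_mem hΛ (by simp [incl])⟩

end Finiteness

/-! ### Coordinate-wise maxima -/

section CoordMax

variable {ι α : Type*} [LinearOrder α] [Zero α] {n : ℕ} {s : Finset ι} {v : ι → Fin n → α}

theorem lt_coordMax_iff (hs : s.Nonempty) {i : Fin n} {a : α} :
    a < coordMax s v i ↔ ∃ x ∈ s, a < v x i := by
  simp [coordMax, hs]

theorem coordMax_le_iff (hs : s.Nonempty) {a : Fin n → α} :
    coordMax s v ≤ a ↔ ∀ x ∈ s, v x ≤ a := by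
  simp only [coordMax, hs, dif_pos, Pi.le_def, Finset.sup'_le_iff]
  exact ⟨fun h x hx i => h i x hx, fun h i x hx => h x hx i⟩

theorem le_coordMax {x : ι} (hx : x ∈ s) : v x ≤ coordMax s v :=
  (coordMax_le_iff ⟨x, hx⟩).1 le_rfl x hx

theorem coordMax_translate {Λ : AddSubgroup (Fin n → ℤ)} {s : Finset Λ} (hs : s.Nonempty)
    (w : Λ) : coordMax (translate s w) (incl Λ) = coordMax s (incl Λ) + incl Λ w := by
  have h : (translate s w).Nonempty := hs.map
  refine le_antisymm ((coordMax_le_iff h).2 fun x hx => ?_) ?_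
  · obtain ⟨y, hy, rfl⟩ := Finset.mem_map.1 hx
    exact add_le_add_left (le_coordMax (v := incl Λ) hy) _
  · rw [← le_sub_iff_add_le, coordMax_le_iff hs]
    intro x hx
    rw [le_sub_iff_add_le]
    exact le_coordMax (v := incl Λ) (Finset.mem_map_of_mem _ hx)

end CoordMax

theorem mem_complexOf_iff {n : ℕ} {α : Type*} [LinearOrder α] [Zero α]
    {Λ : AddSubgroup (Fin n → ℤ)} {v : Λ → Fin n → α} {s : Finset Λ} :
    s ∈ complexOf Λ v ↔ s.Nonempty ∧ ¬ ∃ w : Λ, ∀ i, ∃ x ∈ s, v w i < v x i := by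
  refine and_congr_right fun hs => ?_
  simp [lt_coordMax_iff hs]

/-! ### The Euler characteristic of a finite neighborhood complex -/

section Euler

variable {ι α : Type*} [LinearOrder α] {n : ℕ} {v : ι → Fin n → α}

/-- The points lying strictly below the coordinate-wise maximum of `s`. -/
def strictlyBelow (v : ι → Fin n → α) (s : Finset ι) : Set ι :=
  {w | ∀ i, ∃ x ∈ s, v w i < v x i}

/-- Adding or removing a point strictly below the maximum of `s` does not change the set of points
strictly below this maximum. -/
theorem strictlyBelow_eq_of_mem {s t : Finset ι} {w : ι} (hw : w ∈ strictlyBelow v s)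
    (hst : ∀ x, x ≠ w → (x ∈ s ↔ x ∈ t)) : strictlyBelow v t = strictlyBelow v s := by
  ext u
  refine forall_congr' fun i => ?_
  -- `y` exceeds `w` strictly in coordinate `i`, so it survives the toggling of `w` and can replace
  -- `w` as a witness.
  obtain ⟨y, hy, hwy⟩ := hw i
  have hyw : y ≠ w := by
    rintro rfl
    exact hwy.false
  constructor
  · rintro ⟨x, hx, hux⟩
    rcases eq_or_ne x w with rfl | hxw
    · exact ⟨y, hy, hux.trans hwy⟩
    · exact ⟨x, (hst x hxw).2 hx, hux⟩
  · rintro ⟨x, hx, hux⟩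
    rcases eq_or_ne x w with rfl | hxw
    · exact ⟨y, (hst y hyw).1 hy, hux.trans hwy⟩
    · exact ⟨x, (hst x hxw).1 hx, hux⟩

open Classical in
/-- Toggling a point that depends only on the maximum is a sign-reversing involution. -/
theorem sum_strictlyBelow_nonempty {X : Finset ι} (hX : ∀ s ⊆ X, strictlyBelow v s ⊆ X) :
    ∑ s ∈ X.powerset with (strictlyBelow v s).Nonempty, (-1 : ℤ) ^ s.card = 0 := by
  have hD : ∀ s (hs : (strictlyBelow v s).Nonempty),
      strictlyBelow v (symmDiff s {hs.some}) = strictlyBelow v s := fun s hs =>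
    strictlyBelow_eq_of_mem hs.some_mem fun x hx => by simp [Finset.mem_symmDiff, hx]
  have hne : ∀ s ∈ X.powerset.filter fun s => (strictlyBelow v s).Nonempty,
      (strictlyBelow v s).Nonempty := fun s hs => (Finset.mem_filter.1 hs).2
  refine Finset.sum_involution (fun s hs => symmDiff s {(hne s hs).some}) (fun s hs => ?_)
    (fun s hs _ h => ?_) (fun s hs => ?_) fun s hs => ?_
  · generalize (hne s hs).some = w
    by_cases hw : w ∈ s
    · have h : symmDiff s {w} = s.erase w := by
        ext x
        simp only [Finset.mem_symmDiff, Finset.mem_singleton, Finset.mem_erase]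
        grind
      rw [h, ← Finset.card_erase_add_one hw, pow_succ]
      ring
    · have h : symmDiff s {w} = insert w s := by
        ext x
        simp only [Finset.mem_symmDiff, Finset.mem_singleton, Finset.mem_insert]
        grind
      rw [h, Finset.card_insert_of_notMem hw, pow_succ]
      ring
  · exact Finset.singleton_ne_empty _ (symmDiff_eq_left.1 h)
  · have hs' := Finset.mem_powerset.1 (Finset.mem_filter.1 hs).1
    refine Finset.mem_filter.2 ⟨Finset.mem_powerset.2 fun x hx => ?_, ?_⟩
    · rcases Finset.mem_symmDiff.1 hx with h | h
      · exact hs' h.1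
      · rw [Finset.mem_singleton.1 h.1]
        exact hX s hs' (hne s hs).some_mem
    · rw [hD]
      exact hne s hs
  -- The chosen point is a function of `strictlyBelow v s` alone, which toggling preserves, so the
  -- second toggle uses the same point.
  · simp only [hD]
    rw [symmDiff_assoc, symmDiff_self, symmDiff_bot]

open Classical in
theorem sum_neg_one_pow_dim_eq_one (hn : 0 < n) {X : Finset ι} (hX₀ : X.Nonempty)
    (hX : ∀ s ⊆ X, strictlyBelow v s ⊆ X) :
    ∑ s ∈ X.powerset with s.Nonempty ∧ ¬ (strictlyBelow v s).Nonempty,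
      (-1 : ℤ) ^ (s.card - 1) = 1 := by
  have h₁ := Finset.sum_powerset_neg_one_pow_card_of_nonempty hX₀
  rw [← Finset.sum_filter_add_sum_filter_not _ fun s => (strictlyBelow v s).Nonempty,
    sum_strictlyBelow_nonempty hX, zero_add] at h₁
  have h₂ : X.powerset.filter (fun s => ¬ (strictlyBelow v s).Nonempty) =
      insert ∅ (X.powerset.filter fun s => s.Nonempty ∧ ¬ (strictlyBelow v s).Nonempty) := by
    ext s
    -- Here `0 < n` matters: for `n = 0` the condition would be vacuous. The empty set thus survives
    -- the cancellation, and its term 1 is the final value.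
    have : ¬ (strictlyBelow v ∅).Nonempty := fun ⟨w, hw⟩ => by simpa using hw ⟨0, hn⟩
    rcases s.eq_empty_or_nonempty with rfl | hs
    · simp [this]
    · simp [hs, hs.ne_empty]
  rw [h₂, Finset.sum_insert (by simp), Finset.card_empty, pow_zero] at h₁
  have h₃ : ∑ s ∈ X.powerset with s.Nonempty ∧ ¬ (strictlyBelow v s).Nonempty,
      (-1 : ℤ) ^ s.card = -∑ s ∈ X.powerset with s.Nonempty ∧ ¬ (strictlyBelow v s).Nonempty,
      (-1 : ℤ) ^ (s.card - 1) := by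
    rw [← Finset.sum_neg_distrib]
    refine Finset.sum_congr rfl fun s hs => ?_
    obtain ⟨k, hk⟩ := Nat.exists_eq_add_of_lt (Finset.card_pos.2 (Finset.mem_filter.1 hs).2.1)
    simp [hk, pow_succ]
  rw [h₃] at h₁
  linarith

end Euler

/-! ### Neighborhood complexes -/

/-- The properties of a neighborhood complex on which the generating function depends. -/
structure HasNeighborhoodProperties {n : ℕ} (Λ : AddSubgroup (Fin n → ℤ)) (S : Set (Finset Λ)) :
    Prop where
  nonempty : ∀ s ∈ S, s.Nonempty
  translate_mem : ∀ s ∈ S, ∀ w, translate s w ∈ S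
  exists_range : ∀ s ∈ S, ∃ g : Fin n → Λ, ∀ x, x ∈ s ↔ x ∈ Set.range g
  sum_eq_one : ∀ X : Finset Λ, X.Nonempty →
    (∀ w : Λ, (∀ i, ∃ x ∈ X, incl Λ w i ≤ incl Λ x i) → w ∈ X) →
    ∀ F : Finset (Finset Λ), (∀ s, s ∈ F ↔ s ∈ S ∧ s ⊆ X) → ∑ s ∈ F, (-1 : ℤ) ^ (s.card - 1) = 1

section

variable {n : ℕ} {Λ : AddSubgroup (Fin n → ℤ)}

/-- Treats both kinds of complex at once. Injectivity of coordinates is required only within a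
simplex, since lattice vectors may tie elsewhere even when Λ is generic. -/
theorem hasNeighborhoodProperties_complexOf {α : Type*} [LinearOrder α] [Zero α] (hn : 0 < n)
    {v : Λ → Fin n → α} (hv : ∀ x y i, v x i < v y i → incl Λ x i ≤ incl Λ y i)
    (hadd : ∀ x y i, v x i < v y i → ∀ w, v (x + w) i < v (y + w) i)
    (hinj : ∀ s ∈ complexOf Λ v, ∀ x ∈ s, ∀ y ∈ s, ∀ i, v x i = v y i → x = y) :
    HasNeighborhoodProperties Λ (complexOf Λ v) where
  nonempty s hs := hs.1
  translate_mem s hs w := by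
    rw [mem_complexOf_iff] at hs ⊢
    refine ⟨hs.1.map, fun ⟨u, hu⟩ => hs.2 ⟨u - w, fun i => ?_⟩⟩
    obtain ⟨x, hx, hux⟩ := hu i
    obtain ⟨y, hy, rfl⟩ := Finset.mem_map.1 hx
    refine ⟨y, hy, ?_⟩
    simpa [sub_eq_add_neg] using hadd _ _ i hux (-w)
  exists_range s hs := by
    choose g hg hmax using fun i => Finset.exists_max_image s (fun x => v x i) hs.1
    have heq : ∀ x ∈ s, ∀ i, v x i = v (g i) i → x = g i := fun x hx i => hinj s hs x hx _ (hg i) i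
    refine ⟨g, fun x => ⟨fun hx => ?_, ?_⟩⟩
    · by_contra h
      -- A vertex attaining no coordinate maximum would itself lie strictly below max(s).
      refine (mem_complexOf_iff.1 hs).2 ⟨x, fun i => ⟨g i, hg i, (hmax i x hx).lt_of_ne ?_⟩⟩
      exact fun hi => h ⟨i, (heq x hx i hi).symm⟩
    · rintro ⟨i, rfl⟩
      exact hg i
  sum_eq_one X hX₀ hX F hF := by
    classical
    refine (Finset.sum_congr (Finset.ext fun s => ?_) fun _ _ => rfl).trans
      (sum_neg_one_pow_dim_eq_one (v := v) hn hX₀ fun s hs w hw => hX w fun i => ?_)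
    · rw [hF, mem_complexOf_iff, Finset.mem_filter, Finset.mem_powerset, and_comm]
      rfl
    · obtain ⟨x, hx, h⟩ := hw i
      exact ⟨x, hs hx, hv _ _ i h⟩

theorem IsNeighborhoodComplex.hasNeighborhoodProperties (hn : 0 < n) {S : Set (Finset Λ)}
    (hS : IsNeighborhoodComplex Λ S) : HasNeighborhoodProperties Λ S := by
  rcases hS with ⟨hΛ, rfl⟩ | ⟨φ, hφ, rfl⟩
  · refine hasNeighborhoodProperties_complexOf hn (fun x y i h => h.le)
      (fun x y i h w => by simpa [incl] using h) fun s hs x hx y hy i hxy => ?_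
    by_contra hne
    -- A tie between vertices `x` and `y` yields `u < max(x - y, 0)`; then `u + y < max(x, y)`,
    -- which is impossible in a simplex.
    obtain ⟨u, hu, hlt⟩ := hΛ (x - y : Λ) (x - y).2 (by simpa [sub_eq_zero] using hne)
      ⟨i, by simpa [incl, sub_eq_zero] using hxy⟩
    refine (mem_complexOf_iff.1 hs).2 ⟨⟨u, hu⟩ + y, fun j => ?_⟩
    have := hlt j
    rcases lt_max_iff.1 this with h | h
    · refine ⟨x, hx, ?_⟩
      simp [incl] at h ⊢
      linarith
    · refine ⟨y, hy, ?_⟩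
      simpa [incl] using h
  · exact hasNeighborhoodProperties_complexOf hn hφ.le_of_lt hφ.add_lt_add
      fun s _ x _ y _ i h => by_contra fun hne => hφ.ne_of_ne x y hne i h

end

section GeneratingFunction

variable {d n : ℕ} {A : Matrix (Fin d) (Fin n) ℤ} {Λ : AddSubgroup (Fin n → ℤ)}
  {S R : Set (Finset Λ)} {z : Fin d → ℂ}

/-! ### Absolute convergence of the numerator -/

theorem IsRepresentatives.eq_of_translate (hR : IsRepresentatives S R) {s t : Finset Λ}
    (hs : s ∈ R) (ht : t ∈ R) {w : Λ} (h : s = translate t w) : s = t :=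
  (hR.2 s (hR.1 hs)).unique ⟨hs, 0, by ext; simp [translate]⟩ ⟨ht, w, h⟩

/-- The n nonnegative vectors max(s) - g_i, with g_i running over the vertices, determine s modulo
Λ, and A maps each of them to A max(s). So the norm of the term is the product of the n-th roots of
n equal monomials, and the family is dominated by a convergent sum over n-tuples in ℕⁿ. -/
theorem summable_norm_simplexTerm (hn : 0 < n) (hΛ : ∀ x ∈ Λ, A.mulVec x = 0)
    (hS : HasNeighborhoodProperties Λ S) (hR : IsRepresentatives S R) (hz : ∀ j, z j ≠ 0)
    (hz₁ : ∀ i, ‖monom z (col A i)‖ < 1) :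
    Summable fun s : R => ‖simplexTerm A z (s : Finset Λ)‖ := by
  choose! g hg using hS.exists_range
  have hle : ∀ s ∈ S, ∀ i, 0 ≤ coordMax s (incl Λ) - incl Λ (g s i) := fun s hs i =>
    sub_nonneg.2 (le_coordMax (v := incl Λ) ((hg s hs _).2 ⟨i, rfl⟩))
  let ρ : Fin n → ℝ := fun j => ‖monom z (col A j)‖ ^ (n⁻¹ : ℝ)
  have hρ₀ : ∀ j, 0 ≤ ρ j := fun j => Real.rpow_nonneg (norm_nonneg _) _
  have hρ₁ : ∀ j, ‖ρ j‖ < 1 := fun j => by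
    rw [Real.norm_of_nonneg (hρ₀ j)]
    exact Real.rpow_lt_one (norm_nonneg _) (hz₁ j) (by positivity)
  have hρn : ∀ j, ρ j ^ n = ‖monom z (col A j)‖ := fun j =>
    Real.rpow_inv_natCast_pow (norm_nonneg _) hn.ne'
  have hsum := (hasSum_prod_pi (fun (_ : Fin n) (u : Fin n → ℕ) => ∏ j, ρ j ^ u j)
    fun _ => (hasSum_prod_pow hρ₁).1).2.summable
  let G : R → Fin n → Fin n → ℕ := fun s i j =>
    (coordMax (s : Finset Λ) (incl Λ) j - incl Λ (g s i) j).toNat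
  have hGcast : ∀ (s : R) (i : Fin n), (fun j => (G s i j : ℤ)) =
      coordMax (s : Finset Λ) (incl Λ) - incl Λ (g s i) := fun s i =>
    toNat_cast_of_nonneg (hle s (hR.1 s.2) i)
  -- Equal differences force the vertices of `s` and `t` to differ by one common translation, and
  -- distinct representatives are never translates of each other.
  have hGinj : Function.Injective G := fun s t hst => by
    have hdiff : ∀ i, incl Λ (g s i) - incl Λ (g t i) =
        coordMax (s : Finset Λ) (incl Λ) - coordMax (t : Finset Λ) (incl Λ) := fun i => by
      have h := (hGcast s i).symm.trans ((by rw [hst] : _ = _).trans (hGcast t i))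
      rw [sub_eq_sub_iff_add_eq_add] at h ⊢
      rw [add_comm, ← h, add_comm]
    let i₀ : Fin n := ⟨0, hn⟩
    have hw : ∀ i, g s i = g t i + (g s i₀ - g t i₀) := fun i => by
      have h : incl Λ (g s i) - incl Λ (g t i) = incl Λ (g s i₀) - incl Λ (g t i₀) :=
        (hdiff i).trans (hdiff i₀).symm
      refine Subtype.ext ?_
      rw [AddSubgroup.coe_add, AddSubgroup.coe_sub, ← sub_eq_iff_eq_add']
      exact h
    refine Subtype.ext (hR.eq_of_translate s.2 t.2 (w := g s i₀ - g t i₀) ?_)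
    ext x
    rw [hg s (hR.1 s.2), translate, Finset.mem_map]
    constructor
    · rintro ⟨i, rfl⟩
      exact ⟨g t i, (hg t (hR.1 t.2) _).2 ⟨i, rfl⟩, (hw i).symm⟩
    · rintro ⟨y, hy, rfl⟩
      obtain ⟨i, rfl⟩ := (hg t (hR.1 t.2) _).1 hy
      exact ⟨i, hw i⟩
  refine (hsum.comp_injective hGinj).congr fun s => ?_
  have hpos : ∀ i, 0 ≤ ∏ j, ρ j ^ G s i j := fun i =>
    Finset.prod_nonneg fun j _ => pow_nonneg (hρ₀ j) _
  have hi : ∀ i, (∏ j, ρ j ^ G s i j) ^ n = ‖simplexTerm A z (s : Finset Λ)‖ := fun i => by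
    rw [simplexTerm, norm_mul, norm_pow, norm_neg, norm_one, one_pow, one_mul,
      mulVec_eq_of_sub_mem hΛ (η := coordMax (s : Finset Λ) (incl Λ) - incl Λ (g s i))
        (by simp [incl]), ← hGcast, monom_mulVec_natCast hz, norm_prod, ← Finset.prod_pow]
    exact Finset.prod_congr rfl fun j _ => by rw [norm_pow, ← hρn, pow_right_comm]
  refine (pow_left_inj₀ (Finset.prod_nonneg fun i _ => hpos i) (norm_nonneg _) hn.ne').1 ?_
  rw [← Finset.prod_pow, Finset.prod_congr rfl fun i _ => hi i]
  simp

/-! ### Regrouping by classes modulo the lattice -/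

/-- The simplices lying below a representative of a class of `ℤⁿ ⧸ Λ`. -/
abbrev SimplicesBelow (S : Set (Finset Λ)) (q : (Fin n → ℤ) ⧸ Λ) : Type :=
  {s : Finset Λ // s ∈ S ∧ coordMax s (incl Λ) ≤ q.out}

/-- A simplex s below ξ = `q.out` goes to its representative and the slack ξ - max(s). Conversely,
(t, u) determines the class of max(t) + u, and t is translated so that this vector becomes the
chosen element of its class. -/
theorem exists_equiv_simplicesBelow (hS : HasNeighborhoodProperties Λ S)
    (hR : IsRepresentatives S R) :
    ∃ e : (Σ q : (Fin n → ℤ) ⧸ Λ, SimplicesBelow S q) ≃ R × (Fin n → ℕ), ∀ p,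
      ((e p).1 : Finset Λ).card = p.2.1.card ∧
      coordMax ((e p).1 : Finset Λ) (incl Λ) + (fun i => ((e p).2 i : ℤ)) - p.1.out ∈ Λ := by
  choose! rep hrep huniq using hR.2
  choose! hrepR w hw using hrep
  let f : (Σ q : (Fin n → ℤ) ⧸ Λ, SimplicesBelow S q) → R × (Fin n → ℕ) := fun p =>
    (⟨rep p.2.1, hrepR _ p.2.2.1⟩, fun i => (p.1.out i - coordMax p.2.1 (incl Λ) i).toNat)
  have hfcast : ∀ p, (fun i => ((f p).2 i : ℤ)) = p.1.out - coordMax p.2.1 (incl Λ) := fun p =>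
    toNat_cast_of_nonneg (sub_nonneg.2 p.2.2.2)
  have hmax : ∀ s ∈ S, coordMax s (incl Λ) = coordMax (rep s) (incl Λ) + incl Λ (w s) :=
    fun s hs => by
      conv_lhs => rw [hw s hs]
      exact coordMax_translate (hS.nonempty _ (hR.1 (hrepR s hs))) _
  have hinj : Function.Injective f := by
    rintro ⟨q, s, hs, hsq⟩ ⟨q', s', hs', hsq'⟩ h
    have h₁ : rep s = rep s' := congrArg (fun p => (p.1 : Finset Λ)) h
    have h₂ : q.out - coordMax s (incl Λ) = q'.out - coordMax s' (incl Λ) :=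
      (hfcast ⟨q, s, hs, hsq⟩).symm.trans ((by rw [h] : _ = _).trans (hfcast ⟨q', s', hs', hsq'⟩))
    rw [hmax s hs, hmax s' hs', h₁] at h₂
    have h₃ : q.out - q'.out = incl Λ (w s) - incl Λ (w s') := by
      linear_combination (exp := 1) h₂
    obtain rfl : q = q' := by
      rw [← QuotientAddGroup.out_eq' q, ← QuotientAddGroup.out_eq' q', eq_comm,
        QuotientAddGroup.eq, neg_add_eq_sub, h₃]
      exact Λ.sub_mem (w s).2 (w s').2
    obtain rfl : s = s' := by
      rw [sub_self, eq_comm, sub_eq_zero] at h₃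
      rw [hw s hs, hw s' hs', h₁, Subtype.ext h₃]
    rfl
  have hsurj : Function.Surjective f := by
    rintro ⟨⟨t, ht⟩, u⟩
    let ξ : Fin n → ℤ := coordMax t (incl Λ) + fun i => (u i : ℤ)
    let q : (Fin n → ℤ) ⧸ Λ := QuotientAddGroup.mk ξ
    have hq : q.out - ξ ∈ Λ := by
      rw [← neg_add_eq_sub, ← QuotientAddGroup.eq]
      exact (QuotientAddGroup.out_eq' q).symm
    have htS := hR.1 ht
    have hm := coordMax_translate (hS.nonempty t htS) ⟨_, hq⟩
    have hm' : q.out - coordMax (translate t ⟨_, hq⟩) (incl Λ) = fun i => (u i : ℤ) := by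
      rw [hm]
      simp only [incl, ξ]
      abel
    have hle : coordMax (translate t ⟨_, hq⟩) (incl Λ) ≤ q.out := by
      rw [← sub_nonneg, hm']
      exact fun i => Int.natCast_nonneg _
    have hs := hS.translate_mem t htS ⟨_, hq⟩
    refine ⟨⟨q, _, hs, hle⟩, Prod.ext (Subtype.ext ?_) ?_⟩
    · exact (huniq _ hs t ⟨ht, _, rfl⟩).symm
    · have := hfcast ⟨q, _, hs, hle⟩
      rw [hm'] at this
      exact funext fun i => by exact_mod_cast congrFun this i
  refine ⟨Equiv.ofBijective f ⟨hinj, hsurj⟩, fun p => ⟨?_, ?_⟩⟩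
  · conv_rhs => rw [hw _ p.2.2.1]
    exact (Finset.card_map _).symm
  · change coordMax (rep p.2.1) (incl Λ) + (fun i => ((f p).2 i : ℤ)) - p.1.out ∈ Λ
    rw [hfcast, hmax _ p.2.2.1]
    have : coordMax (rep p.2.1) (incl Λ) + (p.1.out - (coordMax (rep p.2.1) (incl Λ) +
        incl Λ (w p.2.1))) - p.1.out = -incl Λ (w p.2.1) := by abel
    exact this ▸ Λ.neg_mem (w p.2.1).2

theorem coordMax_le_iff_subset (hS : HasNeighborhoodProperties Λ S) {X : Finset Λ}
    {ξ : Fin n → ℤ} (hX : ∀ x, x ∈ X ↔ incl Λ x ≤ ξ) {s : Finset Λ} (hs : s ∈ S) :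
    coordMax s (incl Λ) ≤ ξ ↔ s ⊆ X := by
  rw [coordMax_le_iff (hS.nonempty s hs)]
  exact forall₂_congr fun x _ => (hX x).symm

open Classical in
theorem hasSum_simplicesBelow (hA : ∃ l : Fin d → ℝ, ∀ i, ∑ j, l j * (A j i : ℝ) < 0)
    (hΛ : ∀ x ∈ Λ, A.mulVec x = 0) (hS : HasNeighborhoodProperties Λ S) (q : (Fin n → ℤ) ⧸ Λ) :
    HasSum (fun s : SimplicesBelow S q => (-1 : ℂ) ^ (s.1.card - 1))
      (if ∃ ξ : Fin n → ℤ, 0 ≤ ξ ∧ QuotientAddGroup.mk ξ = q then 1 else 0) := by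
  have hfin := finite_lattice_le hA hΛ q.out
  have hX : ∀ x, x ∈ hfin.toFinset ↔ incl Λ x ≤ q.out := fun x => hfin.mem_toFinset
  let F := hfin.toFinset.powerset.filter fun s => s ∈ S
  have hF : ∀ s, s ∈ F ↔ s ∈ S ∧ s ⊆ hfin.toFinset := fun s => by
    rw [Finset.mem_filter, Finset.mem_powerset, and_comm]
  have hF' : ∀ s, s ∈ F ↔ s ∈ S ∧ coordMax s (incl Λ) ≤ q.out := fun s => by
    rw [hF]
    exact and_congr_right fun hs => (coordMax_le_iff_subset hS hX hs).symm
  have hsum : ∑ s ∈ F, (-1 : ℂ) ^ (s.card - 1) =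
      if ∃ ξ : Fin n → ℤ, 0 ≤ ξ ∧ QuotientAddGroup.mk ξ = q then 1 else 0 := by
    have hiff : (∃ ξ : Fin n → ℤ, 0 ≤ ξ ∧ QuotientAddGroup.mk ξ = q) ↔
        hfin.toFinset.Nonempty := by
      constructor
      · rintro ⟨ξ, hξ, rfl⟩
        have h : (QuotientAddGroup.mk ξ : (Fin n → ℤ) ⧸ Λ).out - ξ ∈ Λ := by
          rw [← neg_add_eq_sub, ← QuotientAddGroup.eq]
          exact (QuotientAddGroup.out_eq' _).symm
        -- For ξ ≥ 0 in the class, `q.out - ξ` is a lattice point below `q.out`; the converse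
        -- subtracts a lattice point from `q.out`.
        exact ⟨⟨_, h⟩, (hX _).2 (sub_le_self _ hξ)⟩
      · rintro ⟨x, hx⟩
        refine ⟨q.out - incl Λ x, sub_nonneg.2 ((hX x).1 hx), ?_⟩
        conv_rhs => rw [← QuotientAddGroup.out_eq' q]
        rw [QuotientAddGroup.eq]
        simp [incl]
    split_ifs with h
    · have := hS.sum_eq_one _ (hiff.1 h) (fun u hu => (hX u).2 fun i => ?_) F hF
      · exact_mod_cast congrArg (Int.cast : ℤ → ℂ) this
      · obtain ⟨x, hx, hux⟩ := hu i
        exact hux.trans ((hX x).1 hx i)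
    · rw [hiff, Finset.not_nonempty_iff_eq_empty] at h
      refine Finset.sum_eq_zero fun s hs => ?_
      have hs' := (hF s).1 hs
      rw [h, Finset.subset_empty] at hs'
      exact absurd hs'.2 (hS.nonempty s hs'.1).ne_empty
  rw [← hsum, ← Finset.sum_coe_sort F]
  let e : {s // s ∈ F} ≃ SimplicesBelow S q := Equiv.subtypeEquivRight hF'
  exact e.hasSum_iff.1 (hasSum_fintype _)

/-- The terms of the expanded generating function. -/
theorem hasSum_simplexTerm_mul (hn : 0 < n) (hΛ : ∀ x ∈ Λ, A.mulVec x = 0)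
    (hS : HasNeighborhoodProperties Λ S) (hR : IsRepresentatives S R) (hz : ∀ j, z j ≠ 0)
    (hz₁ : ∀ i, ‖monom z (col A i)‖ < 1) :
    HasSum (fun p : R × (Fin n → ℕ) => simplexTerm A z (p.1 : Finset Λ) *
      ∏ i, monom z (col A i) ^ p.2 i) (genFun A R z) := by
  let f : R → ℂ := fun s => simplexTerm A z (s : Finset Λ)
  let g : (Fin n → ℕ) → ℂ := fun u => ∏ i, monom z (col A i) ^ u i
  have hf : Summable fun s => ‖f s‖ := summable_norm_simplexTerm hn hΛ hS hR hz hz₁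
  obtain ⟨hg, hg'⟩ : (Summable fun u => ‖g u‖) ∧ HasSum g _ := hasSum_prod_pow hz₁
  have hfg : Summable fun p : R × (Fin n → ℕ) => f p.1 * g p.2 :=
    summable_mul_of_summable_norm hf hg
  rw [genFun, div_eq_mul_inv]
  have h := hf.of_norm.hasSum.mul hg' hfg
  convert h using 1

open Classical in
theorem hasSum_quotient (hn : 0 < n)
    (hA : ∃ l : Fin d → ℝ, ∀ i, ∑ j, l j * (A j i : ℝ) < 0) (hΛ : ∀ x ∈ Λ, A.mulVec x = 0)
    (hS : HasNeighborhoodProperties Λ S) (hR : IsRepresentatives S R) (hz : ∀ j, z j ≠ 0)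
    (hz₁ : ∀ i, ‖monom z (col A i)‖ < 1) :
    HasSum (fun q : (Fin n → ℤ) ⧸ Λ => monom z (A.mulVec q.out) *
      if ∃ ξ : Fin n → ℤ, 0 ≤ ξ ∧ QuotientAddGroup.mk ξ = q then 1 else 0) (genFun A R z) := by
  obtain ⟨e, he⟩ := exists_equiv_simplicesBelow hS hR
  have h := e.hasSum_iff.2 (hasSum_simplexTerm_mul hn hΛ hS hR hz hz₁)
  -- Summing first over the simplices below each class leaves one monomial times an Euler
  -- characteristic.
  refine h.sigma fun q => ?_
  refine ((hasSum_simplicesBelow hA hΛ hS q).mul_left (monom z (A.mulVec q.out))).congr_fun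
    fun s => ?_
  obtain ⟨h₁, h₂⟩ := he ⟨q, s⟩
  rw [Function.comp_apply, simplexTerm, h₁, ← mulVec_eq_of_sub_mem hΛ h₂, Matrix.mulVec_add,
    monom_add hz, monom_mulVec_natCast hz]
  ring

/-! ### Regrouping by right-hand sides -/

/-- A is constant on classes modulo Λ, so a class containing a nonnegative vector belongs to exactly
one right-hand side b. -/
theorem exists_equiv_solutionClasses (hΛ : ∀ x ∈ Λ, A.mulVec x = 0) :
    ∃ e : (Σ b, SolutionClasses A Λ b) ≃
        {q : (Fin n → ℤ) ⧸ Λ | ∃ ξ : Fin n → ℤ, 0 ≤ ξ ∧ QuotientAddGroup.mk ξ = q},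
      ∀ p, A.mulVec (e p : (Fin n → ℤ) ⧸ Λ).out = p.1 := by
  let f : (Σ b, SolutionClasses A Λ b) →
      {q : (Fin n → ℤ) ⧸ Λ | ∃ ξ : Fin n → ℤ, 0 ≤ ξ ∧ QuotientAddGroup.mk ξ = q} := fun p =>
    Quotient.lift (s := solutionSetoid A Λ p.1)
      (fun ξ => ⟨QuotientAddGroup.mk ξ.1, ξ.1, ξ.2.1, rfl⟩)
      (fun ξ η h => Subtype.ext <| by
        rw [eq_comm, QuotientAddGroup.eq, neg_add_eq_sub]
        exact h) p.2
  have hinj : Function.Injective f := by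
    rintro ⟨b, x⟩ ⟨c, y⟩ h
    induction x using Quotient.inductionOn with | _ ξ
    induction y using Quotient.inductionOn with | _ η
    have h' : (QuotientAddGroup.mk ξ.1 : (Fin n → ℤ) ⧸ Λ) = QuotientAddGroup.mk η.1 :=
      congrArg Subtype.val h
    rw [eq_comm, QuotientAddGroup.eq, neg_add_eq_sub] at h'
    obtain rfl : b = c := ξ.2.2.symm.trans ((mulVec_eq_of_sub_mem hΛ h').trans η.2.2)
    exact congrArg (Sigma.mk b) (Quotient.sound (s := solutionSetoid A Λ b) h')
  have hsurj : Function.Surjective f := by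
    rintro ⟨_, ξ, hξ, rfl⟩
    exact ⟨⟨A.mulVec ξ, Quotient.mk (solutionSetoid A Λ _) ⟨ξ, hξ, rfl⟩⟩, rfl⟩
  refine ⟨Equiv.ofBijective f ⟨hinj, hsurj⟩, ?_⟩
  rintro ⟨b, x⟩
  induction x using Quotient.inductionOn with | _ ξ
  refine Eq.trans (mulVec_eq_of_sub_mem hΛ ?_) ξ.2.2
  rw [← neg_add_eq_sub, ← QuotientAddGroup.eq]
  exact (QuotientAddGroup.out_eq' _).symm

theorem hasSum_card_solutionClasses (hn : 0 < n)
    (hA : ∃ l : Fin d → ℝ, ∀ i, ∑ j, l j * (A j i : ℝ) < 0) (hΛ : ∀ x ∈ Λ, A.mulVec x = 0)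
    (hS : HasNeighborhoodProperties Λ S) (hR : IsRepresentatives S R) (hz : ∀ j, z j ≠ 0)
    (hz₁ : ∀ i, ‖monom z (col A i)‖ < 1) :
    HasSum (fun b : Fin d → ℤ => (Nat.card (SolutionClasses A Λ b) : ℂ) * monom z b)
      (genFun A R z) := by
  classical
  obtain ⟨e, he⟩ := exists_equiv_solutionClasses hΛ
  have h := hasSum_quotient hn hA hΛ hS hR hz hz₁
  simp only [mul_ite, mul_one, mul_zero] at h
  have h' : HasSum ((fun q : (Fin n → ℤ) ⧸ Λ => monom z (A.mulVec q.out)) ∘ Subtype.val)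
      (genFun A R z) := hasSum_subtype_iff_indicator.2 h
  refine (e.hasSum_iff.2 h').sigma fun b => ?_
  have := finite_solutionClasses hA Λ b
  have := Fintype.ofFinite (SolutionClasses A Λ b)
  convert hasSum_fintype (fun _ : SolutionClasses A Λ b => monom z b) using 1
  · exact funext fun x => congrArg (monom z) (he ⟨b, x⟩)
  · simp [Nat.card_eq_fintype_card]

theorem card_solutionClasses_eq_indicator (hker : ∀ x, A.mulVec x = 0 → x ∈ Λ) (b : Fin d → ℤ) :
    (Nat.card (SolutionClasses A Λ b) : ℂ) = (semigroupOf A).indicator 1 b := by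
  have hsub : Subsingleton (SolutionClasses A Λ b) := by
    refine ⟨fun x y => ?_⟩
    induction x using Quotient.inductionOn with | _ ξ
    induction y using Quotient.inductionOn with | _ η
    refine Quotient.sound (s := solutionSetoid A Λ b) (hker _ ?_)
    rw [Matrix.mulVec_sub, ξ.2.2, η.2.2, sub_self]
  by_cases hb : b ∈ semigroupOf A
  · obtain ⟨ξ, hξ⟩ := hb
    have : Nonempty (SolutionClasses A Λ b) := ⟨Quotient.mk (solutionSetoid A Λ b) ⟨ξ, hξ⟩⟩
    rw [Set.indicator_of_mem (show b ∈ semigroupOf A from ⟨ξ, hξ⟩), Nat.card_unique]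
    simp
  · have : IsEmpty (SolutionClasses A Λ b) := ⟨fun x => by
      induction x using Quotient.inductionOn with | _ ξ
      exact hb ⟨ξ.1, ξ.2⟩⟩
    simp [hb]

end GeneratingFunction

end NbhdComplex

theorem mainTheorem2 {d n : ℕ} (hn : 0 < n) (A : Matrix (Fin d) (Fin n) ℤ)
    (hA : ∃ l : Fin d → ℝ, ∀ i, ∑ j, l j * (A j i : ℝ) < 0)
    (Λ : AddSubgroup (Fin n → ℤ)) (hΛ : ∀ x ∈ Λ, A.mulVec x = 0)
    (S : Set (Finset Λ)) (hS : NbhdComplex.IsNeighborhoodComplex Λ S)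
    (Sbar : Set (Finset Λ)) (hSbar : NbhdComplex.IsRepresentatives S Sbar) :
    (∀ b, Finite (NbhdComplex.SolutionClasses A Λ b)) ∧
    ∀ z : Fin d → ℂ, (∀ j, z j ≠ 0) →
      (∀ i, ‖NbhdComplex.monom z (NbhdComplex.col A i)‖ < 1) →
      Summable (fun s : Sbar => NbhdComplex.simplexTerm A z (s : Finset Λ)) ∧
      HasSum (fun b : Fin d → ℤ =>
          (Nat.card (NbhdComplex.SolutionClasses A Λ b) : ℂ) * NbhdComplex.monom z b)
        (NbhdComplex.genFun A Sbar z) ∧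
      ((∀ x, A.mulVec x = 0 → x ∈ Λ) →
        HasSum (fun b : NbhdComplex.semigroupOf A => NbhdComplex.monom z (b : Fin d → ℤ))
          (NbhdComplex.genFun A Sbar z)) := by
  have hS' := hS.hasNeighborhoodProperties hn
  refine ⟨NbhdComplex.finite_solutionClasses hA Λ, fun z hz hz₁ => ?_⟩
  have h := NbhdComplex.hasSum_card_solutionClasses hn hA hΛ hS' hSbar hz hz₁
  refine ⟨(NbhdComplex.summable_norm_simplexTerm hn hΛ hS' hSbar hz hz₁).of_norm, h,
    fun hker => (hasSum_subtype_iff_indicator (f := NbhdComplex.monom z)).2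
      (h.congr_fun fun b => ?_)⟩
  rw [NbhdComplex.card_solutionClasses_eq_indicator hker]
  by_cases hb : b ∈ NbhdComplex.semigroupOf A <;> simp [hb]
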